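/- A right module over a small preadditive category $\mathcal A$ is an additive functor $\mathcal A^{\mathrm{op}}\to\mathrm{Ab}$, and $\mathrm{Mod}\text{-}\mathcal A$ denotes the category of right $\mathcal A$-modules; for an associative unital ring $A$, $\mathrm{Mod}\text{-}A$ denotes the category of (unital) right $A$-modules. A recollement of $\mathcal M$ by $\mathcal Y$ and $\mathcal X$ consists of additive functors $i_*\colon\mathcal Y\to\mathcal M$, $i^*,i^!\colon\mathcal M\to\mathcal Y$, $j^*\colon\mathcal M\to\mathcal X$, $j_!,j_*\colon\mathcal X\to\mathcal M$ such that $i^*\dashv i_*\dashv i^!$ and $j_!\dashv j^*\dashv j_*$ are adjoint triples, $i_*,j_!,j_*$ are fully faithful, and the essential image of $i_*$ is the kernel $\{M : j^*M=0\}$ of $j^*$. Two recollements $(\mathcal Y,\mathcal M,\mathcal X)$ and $(\mathcal Y',\mathcal M',\mathcal X')$, with right-hand functors $j^*$ and $(j^*)'$, are equivalent if there are equivalences of categories $\Phi\colon\mathcal M\to\mathcal M'$ and $\Psi\colon\mathcal X\to\mathcal X'$ with $\Psi\circ j^*\cong (j^*)'\circ\Phi$. For an idempotent $e$ of a ring $S$,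 the recollement induced by $e$ is the recollement of $\mathrm{Mod}\text{-}S$ by $\mathrm{Mod}\text{-}S/SeS$ and $\mathrm{Mod}\text{-}eSe$ in which $i_*$ is restriction of scalars along $S\to S/SeS$ and $j^*$ is $M\mapsto Me$ (the remaining functors being their adjoints). **Statement.** Let $\mathcal A$ be a small preadditive category, let $B$ and $C$ be associative unital rings, and let $\mathcal R$ be a recollement of $\mathrm{Mod}\text{-}\mathcal A$ by $\mathcal Y=\mathrm{Mod}\text{-}B$ and $\mathcal X=\mathrm{Mod}\text{-}C$. Then: 1. there is an associative unital ring $A$ such that $\mathrm{Mod}\text{-}\mathcal A$ is equivalent to $\mathrm{Mod}\text{-}A$; 2. for every such ring $A$ there are a ring $S$ Morita equivalent to $A$ (that is, $\mathrm{Mod}\text{-}S\simeq\mathrm{Mod}\text{-}A$) and an idempotent $e\in S$ such that $\mathcal R$ is equivalent to the recollement induced by $e$, with terms $\mathrm{Mod}\text{-}S/SeS$, $\mathrm{Mod}\text{-}S$ and $\mathrm{Mod}\text{-}eSe$. -/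

import Mathlib

open CategoryTheory MulOpposite

universe u

/-- The category of right modules over a small preadditive category `𝒜`: additive functors
`𝒜ᵒᵖ ⥤ Ab` and natural transformations. -/
abbrev RightMod (𝒜 : Type u) [SmallCategory 𝒜] [Preadditive 𝒜] : Type (u + 1) :=
  𝒜ᵒᵖ ⥤+ AddCommGrpCat.{u}

/-- The category of right modules over an associative unital ring `A`, as left modules over the
opposite ring. -/
abbrev RightModRing (A : Type u) [Ring A] : Type (u + 1) :=
  ModuleCat.{u} Aᵐᵒᵖ

section Recollement

universe v₁ v₂ v₃ v₄ v₅ v₆ u₁ u₂ u₃ u₄ u₅ u₆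

/-- A recollement of `ℳ` by `𝒴` and `𝒳`: a diagram of additive functors
`i_* : 𝒴 ⥤ ℳ`, `i^*, i^! : ℳ ⥤ 𝒴`, `j^* : ℳ ⥤ 𝒳`, `j_!, j_* : 𝒳 ⥤ ℳ`. -/
structure Recollement (𝒴 : Type u₁) [Category.{v₁} 𝒴] [Preadditive 𝒴]
    (ℳ : Type u₂) [Category.{v₂} ℳ] [Preadditive ℳ]
    (𝒳 : Type u₃) [Category.{v₃} 𝒳] [Preadditive 𝒳] where
  /-- the functor `i_*` -/
  iLowerStar : 𝒴 ⥤ ℳ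
  /-- the functor `i^*` -/
  iUpperStar : ℳ ⥤ 𝒴
  /-- the functor `i^!` -/
  iUpperShriek : ℳ ⥤ 𝒴
  /-- the functor `j^*` -/
  jUpperStar : ℳ ⥤ 𝒳
  /-- the functor `j_!` -/
  jLowerShriek : 𝒳 ⥤ ℳ
  /-- the functor `j_*` -/
  jLowerStar : 𝒳 ⥤ ℳ
  iLowerStar_additive : iLowerStar.Additive
  iUpperStar_additive : iUpperStar.Additive
  iUpperShriek_additive : iUpperShriek.Additive
  jUpperStar_additive : jUpperStar.Additive
  jLowerShriek_additive : jLowerShriek.Additive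
  jLowerStar_additive : jLowerStar.Additive
  /-- `i^* ⊣ i_*` -/
  adjI₁ : iUpperStar ⊣ iLowerStar
  /-- `i_* ⊣ i^!` -/
  adjI₂ : iLowerStar ⊣ iUpperShriek
  /-- `j_! ⊣ j^*` -/
  adjJ₁ : jLowerShriek ⊣ jUpperStar
  /-- `j^* ⊣ j_*` -/
  adjJ₂ : jUpperStar ⊣ jLowerStar
  iLowerStar_full : iLowerStar.Full
  iLowerStar_faithful : iLowerStar.Faithful
  jLowerShriek_full : jLowerShriek.Full
  jLowerShriek_faithful : jLowerShriek.Faithful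
  jLowerStar_full : jLowerStar.Full
  jLowerStar_faithful : jLowerStar.Faithful
  /-- The (essential) image of `i_*` is the kernel of `j^*`. -/
  image_eq_kernel : ∀ M : ℳ, iLowerStar.essImage M ↔ Limits.IsZero (jUpperStar.obj M)

/-- Equivalence of recollements: equivalences of the middle categories and of the right-hand
categories which commute with the functors `j^*` up to natural isomorphism. -/
def Recollement.IsEquivalent
    {𝒴 : Type u₁} [Category.{v₁} 𝒴] [Preadditive 𝒴]
    {ℳ : Type u₂} [Category.{v₂} ℳ] [Preadditive ℳ]
    {𝒳 : Type u₃} [Category.{v₃} 𝒳] [Preadditive 𝒳]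
    {𝒴' : Type u₆} [Category.{v₆} 𝒴'] [Preadditive 𝒴']
    {ℳ' : Type u₄} [Category.{v₄} ℳ'] [Preadditive ℳ']
    {𝒳' : Type u₅} [Category.{v₅} 𝒳'] [Preadditive 𝒳']
    (R : Recollement 𝒴 ℳ 𝒳) (R' : Recollement 𝒴' ℳ' 𝒳') : Prop :=
  ∃ (Φ : ℳ ≌ ℳ') (Ψ : 𝒳 ≌ 𝒳'),
    Nonempty (R.jUpperStar ⋙ Ψ.functor ≅ Φ.functor ⋙ R'.jUpperStar)

end Recollement

section Corner

variable {S : Type u} [Ring S] {e : S}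

/-- For a right `S`-module `M` and `e : S`, the additive subgroup `M e = {m e | m ∈ M}`. -/
def cornerPart (e : S) (M : Type u) [AddCommGroup M] [Module Sᵐᵒᵖ M] : AddSubgroup M :=
  (DistribSMul.toAddMonoidHom M (op e)).range

theorem op_smul_of_mem_cornerPart (he : IsIdempotentElem e) {M : Type u} [AddCommGroup M]
    [Module Sᵐᵒᵖ M] {m : M} (hm : m ∈ cornerPart e M) : op e • m = m := by
  obtain ⟨n, rfl⟩ := hm
  change op e • op e • n = op e • n
  rw [smul_smul, ← op_mul, he.eq]

theorem corner_mul_right (he : IsIdempotentElem e) (c : he.Corner) : (c.1 : S) * e = c.1 := by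
  obtain ⟨a, ha⟩ := c.2
  rw [← ha, mul_assoc, he.eq]

theorem op_corner_smul_mem (he : IsIdempotentElem e) {M : Type u} [AddCommGroup M]
    [Module Sᵐᵒᵖ M] (c : he.Corner) (m : M) : op (c.1 : S) • m ∈ cornerPart e M := by
  refine ⟨op (c.1 : S) • m, ?_⟩
  change op e • op (c.1 : S) • m = _
  rw [smul_smul, ← op_mul, corner_mul_right he c]

/-- If `e` is idempotent, `M e` is a right module over the corner ring `e S e`, the action being
the restriction of the right action of `S` on `M`. -/
instance cornerModule (he : IsIdempotentElem e) (M : Type u) [AddCommGroup M] [Module Sᵐᵒᵖ M] :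
    Module (he.Corner)ᵐᵒᵖ (cornerPart e M) where
  smul c m := ⟨op (c.unop.1 : S) • (m : M), op_corner_smul_mem he c.unop (m : M)⟩
  one_smul m := Subtype.ext (op_smul_of_mem_cornerPart (M := M) he m.2)
  mul_smul a b m := Subtype.ext (mul_smul (op (a.unop.1 : S)) (op (b.unop.1 : S)) (m : M))
  smul_zero a := Subtype.ext (smul_zero (op (a.unop.1 : S)))
  smul_add a m n := Subtype.ext (smul_add (op (a.unop.1 : S)) (m : M) (n : M))
  add_smul a b m := Subtype.ext (add_smul (op (a.unop.1 : S)) (op (b.unop.1 : S)) (m : M))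
  zero_smul m := Subtype.ext (zero_smul Sᵐᵒᵖ (m : M))

/-- The restriction `M e → N e` of an `S`-linear map `M → N`. -/
def cornerMap (he : IsIdempotentElem e) {M N : Type u} [AddCommGroup M] [Module Sᵐᵒᵖ M]
    [AddCommGroup N] [Module Sᵐᵒᵖ N] (f : M →ₗ[Sᵐᵒᵖ] N) :
    cornerPart e M →ₗ[(he.Corner)ᵐᵒᵖ] cornerPart e N where
  toFun m := ⟨f (m : M), f (m : M), by
    change op e • f (m : M) = f (m : M)
    rw [← map_smul, op_smul_of_mem_cornerPart (M := M) he m.2]⟩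
  map_add' m n := Subtype.ext (map_add f (m : M) (n : M))
  map_smul' c m := Subtype.ext (map_smul f (op (c.unop.1 : S)) (m : M))

/-- The functor `M ↦ M e` from right `S`-modules to right `e S e`-modules. -/
def cornerFunctor (he : IsIdempotentElem e) : RightModRing S ⥤ RightModRing he.Corner where
  obj M := ModuleCat.of _ (cornerPart e M)
  map f := ModuleCat.ofHom (cornerMap he f.hom)
  map_id _ := rfl
  map_comp _ _ := rfl

/-- The quotient ring `S / S e S`. -/
abbrev QuotSeS (e : S) : Type u := (TwoSidedIdeal.span ({e} : Set S)).ringCon.Quotient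

/-- Restriction of scalars along the projection `S → S / S e S`, on right modules. -/
noncomputable def inflationFunctor (e : S) : RightModRing (QuotSeS e) ⥤ RightModRing S :=
  ModuleCat.restrictScalars
    (RingHom.op (TwoSidedIdeal.span ({e} : Set S)).ringCon.mk')

/-- A recollement `Mod (S/SeS) → Mod S → Mod (eSe)` is the one induced by the idempotent `e` if
`i_*` is restriction of scalars along `S → S/SeS` and `j^*` is `M ↦ M e`. The other four functors
are then determined up to unique isomorphism, as the adjoints of these two. -/
def IsInducedByIdempotent (he : IsIdempotentElem e)
    (R : Recollement (RightModRing (QuotSeS e)) (RightModRing S) (RightModRing he.Corner)) :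
    Prop :=
  Nonempty (R.iLowerStar ≅ inflationFunctor e) ∧ Nonempty (R.jUpperStar ≅ cornerFunctor he)

end Corner

/-! The point is to find a progenerator `G` of the middle category having `P = j_!(D)` as a direct
summand, where `D` is the regular module on the right. `P` is compact projective because `j^*`,
having a right adjoint, preserves colimits. The images under `i^*` of the representables separate
modules on the left, and since `1` lies in a finite sum of images, finitely many of them already
detect zero. Let `G` be `P` plus the corresponding representables. If `Hom(G, N) = 0`, then `j^* N =
0`, so `N ≅ i_* Y`, and the chosen representables force `Y = 0` (`exists_progenerator`).

By Gabriel–Popescu and compactness, `Hom(G, ·)` is an equivalence onto right modules over `S = End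
G`. With `e` the projection onto `P`, full faithfulness of `j_!` identifies `eSe` with the ring on
the right, and `Hom(G, N) e = Hom(P, N) = j^* N` (`cornerNatIso`). Modules killed by `e` are exactly
those over `S/SeS`, so the recollement transports to the induced one (`exists_of_equivalences`). -/

open Limits

/-! ### Limits, colimits and AB5 for modules over a preadditive category. -/

namespace AdditiveFunctorCategory

universe v

section

variable {C : Type*} [Category* C] [Preadditive C]

/-- Colimits are pointwise, so additivity may be tested on the legs, where naturality reduces it to
that of the diagram. -/
instance closedUnderColimits (J : Type*) [Category* J] [HasColimitsOfShape J AddCommGrpCat.{v}] :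
    (additiveFunctor C AddCommGrpCat.{v}).IsClosedUnderColimitsOfShape J where
  colimitsOfShape_le := by
    rintro F ⟨h⟩
    refine ⟨fun {X Y f g} => ?_⟩
    have hX := isColimitOfPreserves ((evaluation _ _).obj X) h.isColimit
    refine hX.hom_ext fun j => ?_
    have : (h.diag.obj j).Additive := h.prop_diag_obj j
    have nat := fun k : X ⟶ Y => (h.ι.app j).naturality k
    dsimp at nat ⊢
    rw [Preadditive.comp_add, ← nat, ← nat, ← nat, Functor.map_add, Preadditive.add_comp]

instance closedUnderLimits (J : Type*) [Category* J] [HasLimitsOfShape J AddCommGrpCat.{v}] :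
    (additiveFunctor C AddCommGrpCat.{v}).IsClosedUnderLimitsOfShape J where
  limitsOfShape_le := by
    rintro F ⟨h⟩
    refine ⟨fun {X Y f g} => ?_⟩
    have hY := isLimitOfPreserves ((evaluation _ _).obj Y) h.isLimit
    refine hY.hom_ext fun j => ?_
    have : (h.diag.obj j).Additive := h.prop_diag_obj j
    have nat := fun k : X ⟶ Y => (h.π.app j).naturality k
    dsimp at nat ⊢
    rw [Preadditive.add_comp, nat, nat, nat, Functor.map_add, Preadditive.comp_add]

end

section

variable {C : Type*} [Category* C] [Preadditive C]

instance containsZero : (additiveFunctor C AddCommGrpCat.{v}).ContainsZero where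
  exists_zero := ⟨(Functor.const C).obj (AddCommGrpCat.of PUnit), Functor.isZero _ fun _ =>
    AddCommGrpCat.isZero_of_subsingleton (AddCommGrpCat.of PUnit), ⟨fun {_ _ _ _} =>
      (AddCommGrpCat.isZero_of_subsingleton (AddCommGrpCat.of PUnit)).eq_of_src _ _⟩⟩

instance closedUnderKernels :
    (additiveFunctor C AddCommGrpCat.{v}).IsClosedUnderKernels where
  kernels_le := by
    rintro _ ⟨f, k, hk, hf⟩
    exact ObjectProperty.prop_of_isLimit _ hk (by rintro (_ | _); exacts [hf.1, hf.2])

instance closedUnderCokernels :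
    (additiveFunctor C AddCommGrpCat.{v}).IsClosedUnderCokernels where
  cokernels_le := by
    rintro _ ⟨f, k, hk, hf⟩
    exact ObjectProperty.prop_of_isColimit _ hk (by rintro (_ | _); exacts [hf.1, hf.2])

instance closedUnderFiniteProducts :
    (additiveFunctor C AddCommGrpCat.{v}).IsClosedUnderFiniteProducts where

end

section

variable (𝒜 : Type u) [SmallCategory 𝒜] [Preadditive 𝒜]

instance : HasColimitsOfSize.{u, u} (RightMod 𝒜) := ⟨fun _ _ => inferInstance⟩

instance : HasFilteredColimitsOfSize.{u, u} (RightMod 𝒜) := ⟨fun _ _ _ => inferInstance⟩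

noncomputable instance : Abelian (RightMod 𝒜) := inferInstance

instance : AB5OfSize.{u, u} (RightMod 𝒜) where
  ofShape J _ _ :=
    have : HasExactColimitsOfShape J (𝒜ᵒᵖ ⥤ AddCommGrpCat.{u}) := inferInstance
    have : PreservesFiniteLimits (AdditiveFunctor.forget 𝒜ᵒᵖ AddCommGrpCat.{u}) :=
      ⟨fun _ _ _ => inferInstance⟩
    HasExactColimitsOfShape.domain_of_functor J (AdditiveFunctor.forget 𝒜ᵒᵖ AddCommGrpCat.{u})

/-- The value of a right module at an object. -/
noncomputable abbrev eval (a : 𝒜) : RightMod 𝒜 ⥤ AddCommGrpCat.{u} :=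
  AdditiveFunctor.forget _ _ ⋙ (evaluation _ _).obj (Opposite.op a)

instance : PreservesColimitsOfSize.{u, u} (AdditiveFunctor.forget 𝒜ᵒᵖ AddCommGrpCat.{u}) :=
  ⟨inferInstance⟩

end
end AdditiveFunctorCategory

/-! ### Compact projective objects and progenerators. -/

namespace CompactProgenerator

universe v w

/-- A property of objects closed under colimits holds everywhere if it holds for a separator. -/
theorem prop_of_isSeparator {D : Type w} [Category.{v} D] [Abelian D] [HasColimits D]
    (P : ObjectProperty D)
    (hP : ∀ (J : Type v) [SmallCategory J], P.IsClosedUnderColimitsOfShape J)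
    [P.IsClosedUnderColimitsOfShape WalkingParallelPair]
    {G : D} (hG : IsSeparator G) (h : P G) (X : D) : P X := by
  have sig (J : Type v) : P (∐ fun _ : J => G) :=
    P.prop_colimit _ fun _ => h
  have epi (A : D) := (isSeparator_iff_epi G).1 hG A
  -- Covering `X` and then the kernel of the cover presents `X` as a cokernel between coproducts of
  -- copies of `G`.
  let p := Sigma.desc fun f : G ⟶ X => f
  let q := Sigma.desc fun f : G ⟶ kernel p => f
  have hp : Epi p := epi X
  have hq : Epi q := epi _
  have hc := isCokernelEpiComp (Abelian.epiIsCokernelOfKernel _ (kernelIsKernel p)) q rfl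
  exact P.prop_of_isColimit hc (by rintro (_ | _) <;> exact sig _)

attribute [local instance] Abelian.hasFiniteBiproducts

variable {C : Type w} [Category.{v} C] [Abelian C]

/-- A projective object to which every nonzero object receives a nonzero map is a separator. -/
theorem isSeparator_of_projective (G : C) [Projective G]
    (hG : ∀ N : C, (∀ h : G ⟶ N, h = 0) → IsZero N) : IsSeparator G := by
  rw [Preadditive.isSeparator_iff]
  intro X Y f hf
  -- A map from `G` to the image of `f` lifts to `X` by projectivity, and `hf` kills the lift.
  have hz : IsZero (image f) := hG _ fun h => by
    rw [← cancel_mono (image.ι f), zero_comp, ← Projective.factorThru_comp h (factorThruImage f),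
      Category.assoc, image.fac, hf]
  rw [← image.fac f, hz.eq_of_tgt (factorThruImage f) 0, zero_comp]

/-- A separator `G` for which `Hom(G, ·)` preserves colimits is a progenerator. -/
theorem isEquivalence_preadditiveCoyonedaObj [IsGrothendieckAbelian.{v} C] {G : C}
    (hG : IsSeparator G) [PreservesColimitsOfSize.{v, v} (preadditiveCoyonedaObj G)] :
    (preadditiveCoyonedaObj G).IsEquivalence := by
  have := IsGrothendieckAbelian.GabrielPopescu.full G hG
  have := (isSeparator_iff_faithful_preadditiveCoyonedaObj G).1 hG
  have : PreservesFiniteColimits (preadditiveCoyonedaObj G) :=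
    PreservesColimitsOfSize.preservesFiniteColimits _
  -- The essential image of a fully faithful colimit-preserving functor is closed under colimits,
  -- and it contains the regular module `Hom(G, G)`.
  have : (preadditiveCoyonedaObj G).EssSurj := ⟨by
    refine prop_of_isSeparator (preadditiveCoyonedaObj G).essImage
      (fun J _ => inferInstance) (ModuleCat.isSeparator (End G)ᵐᵒᵖ) ⟨G, ⟨?_⟩⟩
    exact LinearEquiv.toModuleIso ((Preadditive.homSelfLinearEquivEndMulOpposite G).trans
      (Shrink.linearEquiv _ _).symm)⟩
  exact { }

/-- The functor `Hom(X, ·)` with values in abelian groups preserves small colimits. -/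
abbrev IsCompactProjective (X : C) : Prop :=
  PreservesColimitsOfSize.{v, v} (preadditiveCoyoneda.obj (Opposite.op X))

theorem preservesColimits_preadditiveCoyonedaObj (X : C) [h : IsCompactProjective X] :
    PreservesColimitsOfSize.{v, v} (preadditiveCoyonedaObj X) := by
  have : PreservesColimitsOfSize.{v, v} (preadditiveCoyonedaObj X ⋙
    forget₂ (ModuleCat.{v} (End X)ᵐᵒᵖ) AddCommGrpCat.{v}) := h
  have : ReflectsColimitsOfSize.{v, v} (forget₂ (ModuleCat.{v} (End X)ᵐᵒᵖ) AddCommGrpCat.{v}) :=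
    reflectsColimits_of_reflectsIsomorphisms
  exact preservesColimits_of_reflects_of_preserves _ (forget₂ _ AddCommGrpCat.{v})

theorem projective (X : C) [IsCompactProjective X] : Projective X := by
  rw [Projective.projective_iff_preservesEpimorphisms_preadditiveCoyoneda_obj]
  infer_instance

/-- A functor which is a finite sum of retracts of colimit preserving functors preserves
colimits. -/
theorem preservesColimits_of_sum {D : Type*} [Category* D] {ι : Type*} [Fintype ι]
    (H : D ⥤ AddCommGrpCat.{v}) (K : ι → D ⥤ AddCommGrpCat.{v})
    [∀ i, PreservesColimitsOfSize.{v, v} (K i)]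
    (α : ∀ i, H ⟶ K i) (β : ∀ i, K i ⟶ H)
    (hαβ : ∀ X, ∑ i, (α i).app X ≫ (β i).app X = 𝟙 (H.obj X)) :
    PreservesColimitsOfSize.{v, v} H where
  preservesColimitsOfShape {J _} := ⟨fun {F} => ⟨fun {c} hc => ⟨by
    have hK := fun i => isColimitOfPreserves (K i) hc
    -- Pull `s` back along `β i`, descend for each `K i`, and reassemble with the `α i`.
    let s' (s : Cocone (F ⋙ H)) (i : ι) : Cocone (F ⋙ K i) :=
      (Cocone.precompose (Functor.whiskerLeft F (β i))).obj s
    refine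
      { desc s := ∑ i, (α i).app c.pt ≫ (hK i).desc (s' s i)
        fac s j := ?_
        uniq s m hm := ?_ }
    · have : ∀ i, H.map (c.ι.app j) ≫ (α i).app c.pt ≫ (hK i).desc (s' s i) =
          ((α i).app _ ≫ (β i).app _) ≫ s.ι.app j := fun i => by
        have h := (hK i).fac (s' s i) j
        dsimp [s'] at h ⊢
        rw [(α i).naturality_assoc, h, Category.assoc]
      dsimp
      rw [Preadditive.comp_sum, Finset.sum_congr rfl fun i _ => this i, ← Preadditive.sum_comp,
        hαβ, Category.id_comp]
    · have : ∀ i, (β i).app c.pt ≫ m = (hK i).desc (s' s i) := fun i =>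
        (hK i).uniq (s' s i) _ fun j => by
          dsimp [s']
          rw [(β i).naturality_assoc]
          exact congrArg _ (hm j)
      calc m = (∑ i, (α i).app c.pt ≫ (β i).app c.pt) ≫ m := by rw [hαβ]; simp
        _ = _ := by
          rw [Preadditive.sum_comp]
          exact Finset.sum_congr rfl fun i _ => by rw [Category.assoc, this]⟩⟩⟩

theorem isCompactProjective_biproduct {ι : Type} [Fintype ι] (X : ι → C)
    [∀ i, IsCompactProjective (X i)] : IsCompactProjective (⨁ X) := by
  classical
  refine preservesColimits_of_sum _ (fun i => preadditiveCoyoneda.obj (Opposite.op (X i)))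
    (fun i => preadditiveCoyoneda.map (biproduct.ι X i).op)
    (fun i => preadditiveCoyoneda.map (biproduct.π X i).op) fun Y => ?_
  ext (x : ⨁ X ⟶ Y)
  have : ∑ i, biproduct.π X i ≫ biproduct.ι X i ≫ x = x := by
    simp_rw [← Category.assoc, ← Preadditive.sum_comp, biproduct.total, Category.id_comp]
  refine Eq.trans ?_ this
  exact map_sum ((AddMonoidHom.eval (N := ((⨁ X) ⟶ Y)) x).comp
    (AddCommGrpCat.homAddEquiv (M := AddCommGrpCat.of ((⨁ X) ⟶ Y))
      (N := AddCommGrpCat.of ((⨁ X) ⟶ Y))).toAddMonoidHom) _ _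

/-- A left adjoint whose right adjoint has a further right adjoint preserves compact projectives. -/
theorem isCompactProjective_of_adjunction {D : Type*} [Category.{v} D] [Abelian D]
    {F : D ⥤ C} {U : C ⥤ D} [U.Additive] (adj : F ⊣ U) [PreservesColimitsOfSize.{v, v} U]
    (X : D) [IsCompactProjective X] : IsCompactProjective (F.obj X) := by
  have : F.Additive := adj.left_adjoint_additive
  -- `Hom(F X, ·)` is `Hom(X, U ·)`.
  exact preservesColimits_of_natIso (F := U ⋙ preadditiveCoyoneda.obj (Opposite.op X))
    (NatIso.ofComponents (fun Y => (adj.homAddEquiv X Y).symm.toAddCommGrpIso) fun f => by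
      ext g
      exact (adj.homEquiv_naturality_right_symm g f))

/-- `Hom(R, ·)` is the forgetful functor to abelian groups. -/
theorem isCompactProjective_self (R : Type v) [Ring R] :
    IsCompactProjective (ModuleCat.of R R) :=
  preservesColimits_of_natIso (F := forget₂ (ModuleCat.{v} R) AddCommGrpCat.{v})
    (NatIso.ofComponents (fun Y =>
      ((LinearMap.ringLmapEquivSelf R ℤ Y).symm.toAddEquiv.trans
        (ModuleCat.homAddEquiv (M := ModuleCat.of R R) (N := Y)).symm).toAddCommGrpIso)
    fun {Y _} f => by
      ext g
      refine ModuleCat.hom_ext (LinearMap.ext_ring ?_)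
      change (1 : R) • f.hom g = f.hom ((1 : R) • (show Y from g))
      simp)

end CompactProgenerator

/-! ### Representable modules and the additive Yoneda lemma. -/

namespace AdditiveFunctorCategory

variable {𝒜 : Type u} [SmallCategory 𝒜] [Preadditive 𝒜]

/-- The right module represented by an object. -/
noncomputable abbrev representable (a : 𝒜) : RightMod 𝒜 :=
  AdditiveFunctor.of (preadditiveYoneda.obj a)

/-- The additive Yoneda lemma. -/
noncomputable def representableEquiv (a : 𝒜) (N : RightMod 𝒜) :
    N.obj.obj (Opposite.op a) ≃+ (representable a ⟶ N) where
  toFun x := ObjectProperty.homMk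
    { app b := AddCommGrpCat.ofHom
        { toFun (g : b.unop ⟶ a) := N.obj.map g.op x
          map_zero' := by
            change N.obj.map (0 : Opposite.op a ⟶ b) x = 0
            simp
          map_add' g g' := by
            change N.obj.map (g.op + g'.op) x = _
            simp [Functor.map_add] }
      naturality b b' f := by
        ext (g : b.unop ⟶ a)
        change N.obj.map (f.unop ≫ g).op x = N.obj.map f (N.obj.map g.op x)
        simp }
  invFun f := f.hom.app (Opposite.op a) (𝟙 a : a ⟶ a)
  left_inv x := by
    change N.obj.map (𝟙 a).op x = x
    simp
  right_inv f := by
    ext b (g : b.unop ⟶ a)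
    change N.obj.map g.op (f.hom.app (Opposite.op a) (𝟙 a : a ⟶ a)) = f.hom.app b g
    have := ConcreteCategory.congr_hom (f.hom.naturality g.op) (𝟙 a : a ⟶ a)
    refine this.symm.trans ?_
    change f.hom.app b (g ≫ 𝟙 a) = _
    rw [Category.comp_id]
  map_add' x y := by
    ext b (g : b.unop ⟶ a)
    exact map_add (N.obj.map g.op).hom x y

theorem representableEquiv_naturality (a : 𝒜) {N N' : RightMod 𝒜} (f : N ⟶ N')
    (x : N.obj.obj (Opposite.op a)) :
    representableEquiv a N' (f.hom.app _ x) = representableEquiv a N x ≫ f := by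
  ext b (g : b.unop ⟶ a)
  exact (ConcreteCategory.congr_hom (f.hom.naturality g.op) x).symm

/-- By Yoneda, `Hom` out of a representable is evaluation at the object, and colimits are pointwise.
-/
instance isCompactProjective_representable (a : 𝒜) :
    CompactProgenerator.IsCompactProjective (representable a) :=
  preservesColimits_of_natIso (F := eval 𝒜 a)
    (NatIso.ofComponents (fun N => (representableEquiv a N).toAddCommGrpIso) fun {N N'} f => by
      ext x
      exact representableEquiv_naturality a f x)

theorem eq_zero_of_representable {N N' : RightMod 𝒜} (f : N ⟶ N')
    (h : ∀ (a : 𝒜) (g : representable a ⟶ N), g ≫ f = 0) : f = 0 := by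
  ext b x
  have := h b.unop (representableEquiv b.unop N x)
  rw [← representableEquiv_naturality] at this
  exact (representableEquiv b.unop N').map_eq_zero_iff.1 this

end AdditiveFunctorCategory

/-! ### Reduction to finitely many separating modules. -/

namespace CompactProgenerator

/-- Out of a jointly separating family of modules finitely many members detect zero modules. -/
theorem exists_finset_detecting_isZero {R : Type u} [Ring R] {κ : Type*} (X : κ → ModuleCat.{u} R)
    (hX : ∀ ⦃Y Z : ModuleCat.{u} R⦄ (g : Y ⟶ Z), (∀ a (f : X a ⟶ Y), f ≫ g = 0) → g = 0) :
    ∃ t : Finset κ, ∀ Y : ModuleCat.{u} R, (∀ a ∈ t, ∀ f : X a ⟶ Y, f = 0) → IsZero Y := by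
  classical
  -- `N` is the sum of all images in `R` of members of the family. They all die in `R ⧸ N`, so the
  -- quotient map is zero and `1 ∈ N`.
  let N : Submodule R R := ⨆ q : Σ a, (X a ⟶ ModuleCat.of R R), LinearMap.range q.2.hom
  have hN : ModuleCat.ofHom N.mkQ = 0 := hX (Y := ModuleCat.of R R) _ fun a f => by
    ext x
    exact (Submodule.Quotient.mk_eq_zero N).2 (Submodule.mem_iSup_of_mem ⟨a, f⟩ ⟨x, rfl⟩)
  have h1 : (1 : R) ∈ N := by
    rw [← Submodule.Quotient.mk_eq_zero]
    exact ConcreteCategory.congr_hom hN (1 : R)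
  obtain ⟨s, hs⟩ := Submodule.mem_iSup_iff_exists_finset.1 h1
  refine ⟨s.image Sigma.fst, fun Y hY => ?_⟩
  have : Subsingleton Y := subsingleton_of_forall_eq 0 fun y => by
    -- The map `r ↦ r • y` vanishes on the finite subsum containing `1`, hence `y = 0`.
    have : ⨆ q ∈ s, LinearMap.range q.2.hom ≤ LinearMap.ker (LinearMap.toSpanSingleton R Y y) := by
      refine iSup₂_le fun q hq => ?_
      rintro _ ⟨x, rfl⟩
      exact ConcreteCategory.congr_hom (hY q.1 (Finset.mem_image_of_mem _ hq)
        (q.2 ≫ ModuleCat.ofHom (LinearMap.toSpanSingleton R Y y))) x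
    simpa using this hs
  exact ModuleCat.isZero_of_subsingleton Y

end CompactProgenerator

/-! ### The progenerator of a recollement. -/

namespace Recollement

open CompactProgenerator
attribute [local instance] Abelian.hasFiniteBiproducts
universe w

/-- The middle term of a recollement by module categories has a compact projective separator of
which the image of the regular module under `j_!` is a retract. -/
theorem exists_progenerator {C : Type w} [Category.{u} C] [Abelian C] [HasColimits C]
    {κ : Type*} (X : κ → C)
    [∀ a, IsCompactProjective (X a)]
    (hX : ∀ ⦃Y Z : C⦄ (g : Y ⟶ Z), (∀ a (f : X a ⟶ Y), f ≫ g = 0) → g = 0)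
    {B D : Type u} [Ring B] [Ring D] (R : Recollement (ModuleCat.{u} B) C (ModuleCat.{u} D)) :
    ∃ (G : C) (i : R.jLowerShriek.obj (ModuleCat.of D D) ⟶ G)
      (p : G ⟶ R.jLowerShriek.obj (ModuleCat.of D D)),
      i ≫ p = 𝟙 _ ∧ IsCompactProjective G ∧ IsSeparator G := by
  classical
  let P := R.jLowerShriek.obj (ModuleCat.of D D)
  have := R.jUpperStar_additive
  have := R.iLowerStar_additive
  have := R.iUpperStar_additive
  have := R.jLowerShriek_additive
  have := R.iLowerStar_faithful
  have := R.adjJ₂.leftAdjoint_preservesColimits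
  have := isCompactProjective_self D
  have hP : IsCompactProjective P := isCompactProjective_of_adjunction R.adjJ₁ _
  -- The objects `i^* X_a` separate because `Hom(i^* X, Y) = Hom(X, i_* Y)` and `i_*` is faithful.
  obtain ⟨t, ht⟩ := exists_finset_detecting_isZero (fun a => R.iUpperStar.obj (X a)) fun Y Z g hg =>
    R.iLowerStar.map_injective <| by
      rw [Functor.map_zero]
      refine hX _ fun a f => ?_
      have h := hg a ((R.adjI₁.homEquiv _ _).symm f)
      rw [← R.adjI₁.homEquiv_naturality_right_symm] at h
      rw [← (R.adjI₁.homEquiv _ _).symm.injective.eq_iff, h, R.adjI₁.homAddEquiv_symm_zero]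
  -- `none` indexes `P`; `Fin t.card` replaces `t` so that the index set lies in `Type`.
  let F : Option (Fin t.card) → C := fun o => o.elim P fun k => X (t.equivFin.symm k)
  have : ∀ o, IsCompactProjective (F o) := by
    rintro (_ | k)
    exacts [hP, inferInstanceAs (IsCompactProjective (X (t.equivFin.symm k)))]
  have hG : IsCompactProjective (⨁ F) := isCompactProjective_biproduct F
  have := projective (⨁ F)
  refine ⟨⨁ F, biproduct.ι F none, biproduct.π F none, biproduct.ι_π_self F none, hG,
    isSeparator_of_projective _ fun N hN => ?_⟩
  have hF : ∀ o (h : F o ⟶ N), h = 0 := fun o h => by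
    rw [← Category.id_comp h, ← biproduct.ι_π_self F o, Category.assoc, hN (_ ≫ h), comp_zero]
  -- Elements of `j^* N` are maps `D ⟶ j^* N`, that is, maps `P ⟶ N`.
  have hj : IsZero (R.jUpperStar.obj N) := by
    have : Subsingleton (R.jUpperStar.obj N) := subsingleton_of_forall_eq 0 fun y => by
      have h := (R.adjJ₁.homEquiv _ _).symm.injective ((hF none ((R.adjJ₁.homEquiv _ _).symm
        (ModuleCat.ofHom (LinearMap.toSpanSingleton D _ y)))).trans
        (R.adjJ₁.homAddEquiv_symm_zero _ _).symm)
      simpa using ConcreteCategory.congr_hom h (1 : D)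
    exact ModuleCat.isZero_of_subsingleton _
  obtain ⟨Y, ⟨e⟩⟩ := (R.image_eq_kernel N).2 hj
  refine (R.iLowerStar.map_isZero (ht Y fun a ha f => ?_)).of_iso e.symm
  apply (R.adjI₁.homEquiv _ _).injective
  rw [R.adjI₁.homAddEquiv_zero, ← cancel_mono e.hom, zero_comp]
  obtain ⟨k, hk⟩ := t.equivFin.symm.surjective ⟨a, ha⟩
  obtain rfl : (t.equivFin.symm k : κ) = a := congrArg Subtype.val hk
  exact hF (some k) _

end Recollement

/-! ### Modules over `S/SeS` and the kernel of the corner functor. -/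

section Inflation

variable {S : Type u} [Ring S] (e : S)

instance inflationFunctor_additive : (inflationFunctor e).Additive :=
  inferInstanceAs (ModuleCat.restrictScalars _).Additive

instance inflationFunctor_faithful : (inflationFunctor e).Faithful :=
  inferInstanceAs (ModuleCat.restrictScalars _).Faithful

theorem quotSeS_mk_surjective :
    Function.Surjective (RingHom.op (TwoSidedIdeal.span ({e} : Set S)).ringCon.mk') := fun x => by
  obtain ⟨s, hs⟩ := RingCon.mk'_surjective (c := (TwoSidedIdeal.span ({e} : Set S)).ringCon) x.unop
  exact ⟨op s, congrArg op hs⟩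

/-- Since `S → S/SeS` is onto, `S`-linearity already gives linearity over the quotient. -/
instance inflationFunctor_full : (inflationFunctor e).Full where
  map_surjective {M N} f := by
    refine ⟨ModuleCat.ofHom
      { toFun := fun x => f.hom x
        map_add' := map_add f.hom
        map_smul' := fun c x => ?_ }, rfl⟩
    obtain ⟨s, rfl⟩ := quotSeS_mk_surjective e c
    exact map_smul f.hom s (show (inflationFunctor e).obj M from x)

theorem quotSeS_mk_self : (TwoSidedIdeal.span ({e} : Set S)).ringCon.mk' e = 0 :=
  (RingCon.eq _).2 (TwoSidedIdeal.subset_span (Set.mem_singleton e))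

variable {e}

/-- The right action of `S` on a right `S`-module, as a ring homomorphism. -/
def rightAction (M : RightModRing S) : S →+* (AddMonoid.End M)ᵐᵒᵖ where
  toFun s := op (Module.toAddMonoidEnd Sᵐᵒᵖ M (op s))
  map_one' := by simp
  map_mul' s t := by simp
  map_zero' := by simp
  map_add' s t := by simp

/-- The annihilator is a two-sided ideal, so it contains `SeS` once it contains `e`. -/
theorem ringCon_span_le_ker_rightAction (M : RightModRing S) (hM : ∀ m : M, op e • m = 0) :
    (TwoSidedIdeal.span ({e} : Set S)).ringCon ≤ RingCon.ker (rightAction M) := by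
  have : TwoSidedIdeal.span ({e} : Set S) ≤ .ofRingCon (RingCon.ker (rightAction M)) := by
    rw [TwoSidedIdeal.span_le]
    rintro _ rfl
    refine congrArg op (AddMonoidHom.ext fun m => ?_)
    exact (hM m).trans (zero_smul Sᵐᵒᵖ m).symm
  exact TwoSidedIdeal.ringCon_le_iff.1 this

/-- The right action of `S / S e S` on a right `S`-module killed by `e`, as a ring homomorphism. -/
noncomputable def quotSeSAction (M : RightModRing S) (hM : ∀ m : M, op e • m = 0) :
    QuotSeS e →+* (AddMonoid.End M)ᵐᵒᵖ :=
  RingCon.lift _ (rightAction M) (ringCon_span_le_ker_rightAction M hM)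

/-- A right `S`-module killed by `e` is a right module over `S / S e S`. -/
noncomputable abbrev quotSeSModule (M : RightModRing S) (hM : ∀ m : M, op e • m = 0) :
    Module (QuotSeS e)ᵐᵒᵖ M where
  smul c m := (quotSeSAction M hM c.unop).unop m
  one_smul m := by
    change (quotSeSAction M hM 1).unop m = m
    rw [map_one]; rfl
  mul_smul c d m := by
    change (quotSeSAction M hM (d.unop * c.unop)).unop m = _
    rw [map_mul]; rfl
  smul_zero c := map_zero (quotSeSAction M hM c.unop).unop
  smul_add c := map_add (quotSeSAction M hM c.unop).unop
  add_smul c d m := by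
    change (quotSeSAction M hM (c.unop + d.unop)).unop m = _
    rw [map_add]; rfl
  zero_smul m := by
    change (quotSeSAction M hM 0).unop m = _
    rw [map_zero]; rfl

theorem inflationFunctor_essImage_iff (M : RightModRing S) :
    (inflationFunctor e).essImage M ↔ ∀ m : M, op e • m = 0 := by
  constructor
  · rintro ⟨N, ⟨f⟩⟩ m
    have h (n : (inflationFunctor e).obj N) : op e • n = 0 := by
      change (op ((TwoSidedIdeal.span ({e} : Set S)).ringCon.mk' e) • (show N from n)) = 0
      rw [quotSeS_mk_self, MulOpposite.op_zero, zero_smul]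
    have := h (f.inv.hom m)
    rw [← map_smul] at this
    simpa using congrArg f.hom.hom this
  · intro hM
    let _ := quotSeSModule M hM
    let N : ModuleCat Sᵐᵒᵖ := (inflationFunctor e).obj (ModuleCat.of (QuotSeS e)ᵐᵒᵖ M)
    let f : N ≃ₗ[Sᵐᵒᵖ] M := { AddEquiv.refl M with map_smul' := fun s m => rfl }
    exact ⟨ModuleCat.of (QuotSeS e)ᵐᵒᵖ M, ⟨f.toModuleIso⟩⟩

theorem isZero_cornerFunctor_iff (he : IsIdempotentElem e) (M : RightModRing S) :
    IsZero ((cornerFunctor he).obj M) ↔ ∀ m : M, op e • m = 0 := by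
  constructor
  · intro h m
    have : Subsingleton (cornerPart e M) := ModuleCat.subsingleton_of_isZero h
    exact congrArg Subtype.val (Subsingleton.elim (α := cornerPart e M) ⟨op e • m, m, rfl⟩ 0)
  · intro h
    have : Subsingleton (cornerPart e M) := subsingleton_of_forall_eq 0 fun x => by
      obtain ⟨_, m, rfl⟩ := x
      exact Subtype.ext (h m)
    exact ModuleCat.isZero_of_subsingleton (ModuleCat.of he.Cornerᵐᵒᵖ (cornerPart e M))

instance cornerFunctor_additive (he : IsIdempotentElem e) : (cornerFunctor he).Additive where

end Inflation

/-! ### Transport of recollements along equivalences. -/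

namespace CategoryTheory.Functor

variable {𝒴 𝒴' ℳ : Type*} [Category* 𝒴] [Category* 𝒴'] [Category* ℳ]

/-- Fully faithful functors with the same essential image differ by an equivalence of their
sources. -/
theorem exists_equivalence_of_essImage_eq (F : 𝒴 ⥤ ℳ) (F' : 𝒴' ⥤ ℳ) [F.Full] [F.Faithful]
    [F'.Full] [F'.Faithful] (h : F.essImage = F'.essImage) :
    ∃ E : 𝒴 ≌ 𝒴', Nonempty (E.functor ⋙ F' ≅ F) := by
  let E : 𝒴 ⥤ 𝒴' := F'.essImage.lift F (fun X => h ▸ F.obj_mem_essImage X) ⋙ F'.toEssImage.inv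
  let i : E ⋙ F' ≅ F :=
    isoWhiskerLeft (F'.essImage.lift F (fun X => h ▸ F.obj_mem_essImage X))
      (isoWhiskerRight F'.toEssImage.asEquivalence.counitIso F'.essImage.ι)
  have : (E ⋙ F').Full := Full.of_iso i.symm
  have : (E ⋙ F').Faithful := Faithful.of_iso i.symm
  have : E.Full := Full.of_comp_faithful E F'
  have : E.Faithful := Faithful.of_comp E F'
  have : E.EssSurj := ⟨fun Y => by
    have hY : F.essImage (F'.obj Y) := h ▸ F'.obj_mem_essImage Y
    exact ⟨hY.witness, ⟨F'.preimageIso (i.app _ ≪≫ hY.getIso)⟩⟩⟩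
  have : E.IsEquivalence := { }
  exact ⟨E.asEquivalence, ⟨i⟩⟩

end CategoryTheory.Functor

namespace Recollement

section Transport

variable {𝒴 ℳ 𝒳 𝒴' ℳ' 𝒳' : Type*} [Category* 𝒴] [Category* ℳ] [Category* 𝒳] [Category* 𝒴']
  [Category* ℳ'] [Category* 𝒳'] [Preadditive 𝒴] [Preadditive ℳ] [Preadditive 𝒳] [Preadditive 𝒴']
  [Preadditive ℳ'] [Preadditive 𝒳']

/-- Functors `i'` and `j'` are part of a recollement if `j'` is equivalent to the functor `j^*` of
a given recollement, and `i'` is fully faithful with essential image the kernel of `j'`. -/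
theorem exists_of_equivalences (R : Recollement 𝒴 ℳ 𝒳) (Φ : ℳ ≌ ℳ') (Ψ : 𝒳 ≌ 𝒳')
    (i' : 𝒴' ⥤ ℳ') (j' : ℳ' ⥤ 𝒳') [i'.Additive] [j'.Additive] [i'.Full] [i'.Faithful]
    (σ : R.jUpperStar ⋙ Ψ.functor ≅ Φ.functor ⋙ j')
    (h : ∀ M, i'.essImage M ↔ IsZero (j'.obj M)) :
    ∃ R' : Recollement 𝒴' ℳ' 𝒳', R'.iLowerStar = i' ∧ R'.jUpperStar = j' := by
  have := R.iLowerStar_full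
  have := R.iLowerStar_faithful
  have := R.jLowerShriek_full
  have := R.jLowerShriek_faithful
  have := R.jLowerStar_full
  have := R.jLowerStar_faithful
  let τ : (Φ.inverse ⋙ R.jUpperStar) ⋙ Ψ.functor ≅ j' :=
    Functor.associator _ _ _ ≪≫ Functor.isoWhiskerLeft Φ.inverse σ ≪≫
      (Functor.associator _ _ _).symm ≪≫ Functor.isoWhiskerRight Φ.counitIso j' ≪≫
      j'.leftUnitor
  -- Both sides are the kernel of `j'`, the right one by way of `τ` and the kernel condition of `R`.
  have himage : i'.essImage = (R.iLowerStar ⋙ Φ.functor).essImage := by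
    ext M
    rw [h, ← (τ.app M).isZero_iff]
    change IsZero (Ψ.functor.obj (R.jUpperStar.obj (Φ.inverse.obj M))) ↔ _
    have hΨ : IsZero (Ψ.functor.obj (R.jUpperStar.obj (Φ.inverse.obj M))) ↔
        IsZero (R.jUpperStar.obj (Φ.inverse.obj M)) :=
      ⟨fun hz => (Ψ.inverse.map_isZero hz).of_iso (Ψ.unitIso.app _), Ψ.functor.map_isZero⟩
    rw [hΨ, ← R.image_eq_kernel]
    constructor
    · rintro ⟨Y, ⟨f⟩⟩
      exact ⟨Y, ⟨Φ.functor.mapIso f ≪≫ Φ.counitIso.app M⟩⟩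
    · rintro ⟨Y, ⟨f⟩⟩
      exact ⟨Y, ⟨Φ.unitIso.app _ ≪≫ Φ.inverse.mapIso f⟩⟩
  obtain ⟨E, ⟨ε⟩⟩ := Functor.exists_equivalence_of_essImage_eq i' (R.iLowerStar ⋙ Φ.functor) himage
  -- The missing adjoints are those of `R` conjugated by the equivalences, with `ε` and `τ`
  -- correcting the other side.
  let adjI₁ : (Φ.inverse ⋙ R.iUpperStar) ⋙ E.inverse ⊣ i' :=
    ((Φ.symm.toAdjunction.comp R.adjI₁).comp E.symm.toAdjunction).ofNatIsoRight ε
  let adjI₂ : i' ⊣ (Φ.inverse ⋙ R.iUpperShriek) ⋙ E.inverse :=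
    (E.toAdjunction.comp (R.adjI₂.comp Φ.toAdjunction)).ofNatIsoLeft ε
  let adjJ₁ : Ψ.inverse ⋙ R.jLowerShriek ⋙ Φ.functor ⊣ j' :=
    (Ψ.symm.toAdjunction.comp (R.adjJ₁.comp Φ.toAdjunction)).ofNatIsoRight τ
  let adjJ₂ : j' ⊣ Ψ.inverse ⋙ R.jLowerStar ⋙ Φ.functor :=
    ((Φ.symm.toAdjunction.comp R.adjJ₂).comp Ψ.toAdjunction).ofNatIsoLeft τ
  exact ⟨{
    iLowerStar := i'
    iUpperStar := _
    iUpperShriek := _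
    jUpperStar := j'
    jLowerShriek := _
    jLowerStar := _
    iLowerStar_additive := inferInstance
    iUpperStar_additive := adjI₁.left_adjoint_additive
    iUpperShriek_additive := adjI₂.right_adjoint_additive
    jUpperStar_additive := inferInstance
    jLowerShriek_additive := adjJ₁.left_adjoint_additive
    jLowerStar_additive := adjJ₂.right_adjoint_additive
    adjI₁ := adjI₁
    adjI₂ := adjI₂
    adjJ₁ := adjJ₁
    adjJ₂ := adjJ₂
    iLowerStar_full := inferInstance
    iLowerStar_faithful := inferInstance
    jLowerShriek_full := inferInstance
    jLowerShriek_faithful := inferInstance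
    jLowerStar_full := inferInstance
    jLowerStar_faithful := inferInstance
    image_eq_kernel := h }, rfl, rfl⟩

end Transport

end Recollement

/-! ### Corners of `End G` and retracts of `G`. -/

section CornerEnd

universe w

/-- The endomorphism of `G` defined by maps to and from a retract. -/
abbrev retractEnd {C : Type*} [Category* C] {X G : C} (i : X ⟶ G) (p : G ⟶ X) : End G := p ≫ i

theorem isIdempotentElem_retractEnd {C : Type*} [Category* C] {X G : C} {i : X ⟶ G} {p : G ⟶ X}
    (h : i ≫ p = 𝟙 _) :
    IsIdempotentElem (retractEnd i p) := by
  change (p ≫ i) ≫ p ≫ i = p ≫ i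
  simp [reassoc_of% h]

variable {C : Type w} [Category.{u} C] [Preadditive C] {D : Type u} [Ring D]
  {j : C ⥤ ModuleCat.{u} D} {l : ModuleCat.{u} D ⥤ C} [l.Additive] [l.Full] [l.Faithful]
  {G : C} {i : l.obj (ModuleCat.of D D) ⟶ G} {p : G ⟶ l.obj (ModuleCat.of D D)}

/-- The morphism from the regular module determined by an element. -/
abbrev spanHom {N : ModuleCat.{u} D} (x : N) : ModuleCat.of D D ⟶ N :=
  ModuleCat.ofHom (LinearMap.toSpanSingleton D N x)

theorem spanHom_apply_one {N : ModuleCat.{u} D} (f : ModuleCat.of D D ⟶ N) :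
    spanHom (f.hom (1 : D)) = f := by
  ext
  simp

theorem spanHom_smul {N : ModuleCat.{u} D} (d : D) (x : N) :
    spanHom (d • x) = spanHom (N := ModuleCat.of D D) d ≫ spanHom x := by
  ext
  simp

theorem spanHom_add {N : ModuleCat.{u} D} (x y : N) :
    spanHom (x + y) = spanHom x + spanHom y := by
  ext
  simp

/-- If the image of the regular module under a fully faithful functor is a retract of `G`, then the
ring is the opposite of the corresponding corner of `End G`. -/
def cornerHom (h : i ≫ p = 𝟙 _) : D →+* ((isIdempotentElem_retractEnd h).Corner)ᵐᵒᵖ where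
  -- The `op` arises because `D` acts on itself by right multiplications and products in `End G`
  -- reverse `≫`.
  toFun d := op ⟨p ≫ l.map (spanHom (N := ModuleCat.of D D) d) ≫ i,
    (Subsemigroup.mem_corner_iff (isIdempotentElem_retractEnd h)).2 ⟨by
      change (p ≫ _ ≫ i) ≫ (p ≫ i) = _
      simp [reassoc_of% h], by
      change (p ≫ i) ≫ (p ≫ _ ≫ i) = _
      simp [reassoc_of% h]⟩⟩
  map_one' := by
    refine congrArg op (Subtype.ext ?_)
    change p ≫ l.map (spanHom (N := ModuleCat.of D D) (1 : D)) ≫ i = p ≫ i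
    rw [spanHom_apply_one (𝟙 (ModuleCat.of D D))]
    simp
  map_mul' d d' := by
    refine congrArg op (Subtype.ext ?_)
    change p ≫ l.map (spanHom (N := ModuleCat.of D D) (d * d')) ≫ i =
      (p ≫ l.map (spanHom (N := ModuleCat.of D D) d) ≫ i) ≫
      (p ≫ l.map (spanHom (N := ModuleCat.of D D) d') ≫ i)
    have := spanHom_smul (N := ModuleCat.of D D) d d'
    rw [smul_eq_mul] at this
    rw [this]
    simp [reassoc_of% h]
  map_zero' := by
    refine congrArg op (Subtype.ext ?_)
    change p ≫ l.map (spanHom (N := ModuleCat.of D D) (0 : D)) ≫ i = 0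
    rw [spanHom_apply_one (0 : ModuleCat.of D D ⟶ ModuleCat.of D D)]
    simp
  map_add' d d' := by
    refine congrArg op (Subtype.ext ?_)
    change p ≫ l.map (spanHom (N := ModuleCat.of D D) (d + d')) ≫ i =
      (p ≫ l.map (spanHom (N := ModuleCat.of D D) d) ≫ i) +
      (p ≫ l.map (spanHom (N := ModuleCat.of D D) d') ≫ i)
    rw [spanHom_add]
    simp

/-- The corner is `End (l D)`, which is `End D` since `l` is fully faithful. -/
theorem cornerHom_bijective (h : i ≫ p = 𝟙 _) : Function.Bijective (cornerHom h) := by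
  constructor
  · rw [injective_iff_map_eq_zero]
    intro d hd
    have hd : p ≫ l.map (spanHom (N := ModuleCat.of D D) d) ≫ i = 0 :=
      congrArg (fun c : ((isIdempotentElem_retractEnd h).Corner)ᵐᵒᵖ => c.unop.1) hd
    have hd := i ≫= hd =≫ p
    simp only [Category.assoc, h, reassoc_of% h, Category.comp_id, comp_zero, zero_comp] at hd
    rw [l.map_eq_zero_iff] at hd
    simpa using ConcreteCategory.congr_hom hd (1 : D)
  · intro c
    obtain ⟨f, hf⟩ := l.map_surjective (i ≫ (c.unop.1 : G ⟶ G) ≫ p)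
    obtain ⟨h₁, h₂⟩ := (Subsemigroup.mem_corner_iff (isIdempotentElem_retractEnd h)).1 c.unop.2
    refine ⟨f.hom (1 : D), congrArg op (Subtype.ext ?_)⟩
    change p ≫ l.map (spanHom (N := ModuleCat.of D D) (f.hom (1 : D))) ≫ i = _
    rw [spanHom_apply_one, hf]
    change (c.unop.1 : G ⟶ G) ≫ (p ≫ i) = _ at h₁
    change (p ≫ i) ≫ (c.unop.1 : G ⟶ G) = _ at h₂
    simp only [Category.assoc] at h₁ h₂ ⊢
    rw [h₁, h₂]
    rfl

/-- The ring isomorphism between a ring and the opposite of the corner of `End G` belonging to the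
image of the regular module. -/
noncomputable def cornerEquiv (h : i ≫ p = 𝟙 _) :
    D ≃+* ((isIdempotentElem_retractEnd h).Corner)ᵐᵒᵖ :=
  RingEquiv.ofBijective (cornerHom h) (cornerHom_bijective h)

variable [j.Additive]
/-- Elements of `j N` are maps out of the retract of `G`, that is, elements of `Hom(G, N) e`. -/
noncomputable def cornerLinearEquiv (adj : l ⊣ j) (h : i ≫ p = 𝟙 _) (N : C) :
    (ModuleCat.restrictScalars (cornerEquiv h).symm.toRingHom).obj (j.obj N)
      ≃ₗ[((isIdempotentElem_retractEnd h).Corner)ᵐᵒᵖ]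
      (cornerFunctor (isIdempotentElem_retractEnd h)).obj ((preadditiveCoyonedaObj G).obj N) :=
  LinearEquiv.ofBijective
    (M := (ModuleCat.restrictScalars (cornerEquiv h).symm.toRingHom).obj (j.obj N))
    (M₂ := (cornerFunctor (isIdempotentElem_retractEnd h)).obj ((preadditiveCoyonedaObj G).obj N))
    { toFun (x : j.obj N) := ⟨p ≫ (adj.homEquiv _ _).symm (spanHom x),
        p ≫ (adj.homEquiv _ _).symm (spanHom x), by
          change (p ≫ i) ≫ p ≫ _ = p ≫ _
          simp [reassoc_of% h]⟩
      map_add' (x : j.obj N) (y : j.obj N) := Subtype.ext (by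
        change p ≫ (adj.homEquiv _ _).symm (spanHom (x + y)) =
          p ≫ (adj.homEquiv _ _).symm (spanHom x) + p ≫ (adj.homEquiv _ _).symm (spanHom y)
        rw [spanHom_add, adj.homAddEquiv_symm_add, Preadditive.comp_add])
      map_smul' c (x : j.obj N) := Subtype.ext (by
        obtain ⟨d, rfl⟩ := (cornerEquiv h).surjective c
        change p ≫ (adj.homEquiv _ _).symm (spanHom ((cornerEquiv h).symm (cornerEquiv h d) • x)) =
          (p ≫ l.map (spanHom (N := ModuleCat.of D D) d) ≫ i) ≫
            p ≫ (adj.homEquiv _ _).symm (spanHom x)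
        rw [RingEquiv.symm_apply_apply, spanHom_smul, adj.homEquiv_naturality_left_symm]
        simp [reassoc_of% h]) } <| by
    constructor
    · intro (x : j.obj N) (y : j.obj N) hxy
      have hxy : p ≫ (adj.homEquiv _ _).symm (spanHom x) =
        p ≫ (adj.homEquiv _ _).symm (spanHom y) := congrArg Subtype.val hxy
      have hxy := i ≫= hxy
      rw [reassoc_of% h, reassoc_of% h] at hxy
      have := ConcreteCategory.congr_hom ((adj.homEquiv _ _).symm.injective hxy) (1 : D)
      change x = y
      simpa using this
    · rintro ⟨_, (m : G ⟶ N), rfl⟩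
      -- The preimage of `m e` is the value at `1` of the transpose of `i ≫ m`.
      refine ⟨(adj.homEquiv _ _ (i ≫ m)).hom (1 : D), Subtype.ext ?_⟩
      change p ≫ (adj.homEquiv _ _).symm (spanHom ((adj.homEquiv _ _ (i ≫ m)).hom (1 : D))) =
        (p ≫ i) ≫ m
      rw [spanHom_apply_one, Equiv.symm_apply_apply, Category.assoc]

/-- Under `Hom(G, ·)`, the functor `j` becomes the functor `M ↦ M e`. -/
noncomputable def cornerNatIso (adj : l ⊣ j) (h : i ≫ p = 𝟙 _) :
    j ⋙ ModuleCat.restrictScalars (cornerEquiv h).symm.toRingHom ≅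
      preadditiveCoyonedaObj G ⋙ cornerFunctor (isIdempotentElem_retractEnd h) :=
  NatIso.ofComponents (fun N => (cornerLinearEquiv adj h N).toModuleIso) fun {N N'} f => by
    ext (x : j.obj N)
    refine Subtype.ext ?_
    change p ≫ (adj.homEquiv _ _).symm (spanHom ((j.map f).hom x)) =
      (p ≫ (adj.homEquiv _ _).symm (spanHom x)) ≫ f
    rw [Category.assoc, ← adj.homEquiv_naturality_right_symm]
    congr 2
    ext
    simp

end CornerEnd

/-- A recollement of a category with a compact projective generator `G`, of which the image of the
ring under `j_!` is a retract, is induced by an idempotent of `End G`. -/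
theorem Recollement.exists_isInducedByIdempotent {C : Type*} [Category.{u} C] [Preadditive C]
    {B D : Type u} [Ring B] [Ring D] (R : Recollement (ModuleCat.{u} B) C (ModuleCat.{u} D))
    {G : C} {i : R.jLowerShriek.obj (ModuleCat.of D D) ⟶ G}
    {p : G ⟶ R.jLowerShriek.obj (ModuleCat.of D D)} (h : i ≫ p = 𝟙 _)
    (hG : (preadditiveCoyonedaObj G).IsEquivalence) :
    ∃ (e : End G) (he : IsIdempotentElem e)
      (R' : Recollement (RightModRing (QuotSeS e)) (RightModRing (End G))
        (RightModRing he.Corner)),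
      IsInducedByIdempotent he R' ∧ R.IsEquivalent R' := by
  have := R.jLowerShriek_additive
  have := R.jLowerShriek_full
  have := R.jLowerShriek_faithful
  have := R.jUpperStar_additive
  let he := isIdempotentElem_retractEnd h
  let Φ : C ≌ RightModRing (End G) := (preadditiveCoyonedaObj G).asEquivalence
  let Ψ : ModuleCat.{u} D ≌ RightModRing he.Corner :=
    (ModuleCat.restrictScalarsEquivalenceOfRingEquiv (cornerEquiv h).symm)
  let σ : R.jUpperStar ⋙ Ψ.functor ≅ Φ.functor ⋙ cornerFunctor he := cornerNatIso R.adjJ₁ h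
  obtain ⟨R', hi, hj⟩ := R.exists_of_equivalences Φ Ψ (inflationFunctor (retractEnd i p))
    (cornerFunctor he) σ
    fun M => (inflationFunctor_essImage_iff M).trans (isZero_cornerFunctor_iff he M).symm
  exact ⟨retractEnd i p, he, R', ⟨⟨eqToIso hi⟩, ⟨eqToIso hj⟩⟩, Φ, Ψ,
    ⟨σ ≪≫ Functor.isoWhiskerLeft Φ.functor (eqToIso hj.symm)⟩⟩

theorem mainTheorem7 (𝒜 : Type u) [SmallCategory 𝒜] [Preadditive 𝒜]
    (B : Type u) [Ring B] (C : Type u) [Ring C]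
    (R : Recollement (RightModRing B) (RightMod 𝒜) (RightModRing C)) :
    (∃ (A : Type u) (_ : Ring A), Nonempty (RightMod 𝒜 ≌ RightModRing A)) ∧
    (∀ (A : Type u) [Ring A], Nonempty (RightMod 𝒜 ≌ RightModRing A) →
      ∃ (S : Type u) (_ : Ring S), Nonempty (RightModRing S ≌ RightModRing A) ∧
        ∃ (e : S) (he : IsIdempotentElem e)
        (R' : Recollement (RightModRing (QuotSeS e)) (RightModRing S) (RightModRing he.Corner)),
        IsInducedByIdempotent he R' ∧ R.IsEquivalent R') := by
  obtain ⟨G, i, p, h, hG, hsep⟩ := R.exists_progenerator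
    (fun a : 𝒜 => AdditiveFunctorCategory.representable a)
    fun _ _ g => AdditiveFunctorCategory.eq_zero_of_representable g
  have : HasSeparator (RightMod 𝒜) := ⟨G, hsep⟩
  have : IsGrothendieckAbelian.{u} (RightMod 𝒜) := { }
  have := CompactProgenerator.preservesColimits_preadditiveCoyonedaObj G
  have hE := CompactProgenerator.isEquivalence_preadditiveCoyonedaObj hsep
  refine ⟨⟨End G, inferInstance, ⟨(preadditiveCoyonedaObj G).asEquivalence⟩⟩, ?_⟩
  rintro A _ ⟨α⟩
  -- `S = End G` does not depend on `A`; `α` enters only through the Morita equivalence.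
  exact ⟨End G, inferInstance, ⟨(preadditiveCoyonedaObj G).asEquivalence.symm.trans α⟩,
    R.exists_isInducedByIdempotent h hE⟩
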